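/- Let $K$ be an arbitrary field. A plane curve of degree $d$ over $K$ means a projective, geometrically irreducible plane curve, i.e. one given by a homogeneous polynomial $F\in K[X,Y,Z]$ of degree $d$ that is irreducible over an algebraic closure of $K$. A branch of the curve defined over $K$ is an equivalence class of primitive branch representations with coefficients in $K$: non-constant points $(x(t):y(t):z(t))$ with $x,y,z\in K[[t]]$ not all divisible by $t$ and $F(x(t),y(t),z(t))=0$, which are not, up to a common factor, obtained from power series by substituting some $s(t)\in K[[t]]$ of order at least $2$; two representations are equivalent if they differ by a common factor and a substitution $t\mapsto s(t)$ with $s\in K[[t]]$ of order $1$. A plane model of the curve is a plane curve over $K$ that is birationally equivalent to it over $K$, i.e. whose function field is isomorphic to that of the given curve over $K$. Let $\mathcal F$ be a plane curve over $K$ with at least two distinct branches defined over $K$. Then $\mathcal F$ has a plane model $\mathcal G$ over $K$ satisfying (H) $\mathcal G$ has two distinct singular points $P_1,P_2$ defined over $K$ whose multiplicities $r_1,r_2\ge 2$ on $\mathcal G$ satisfy $r_1+r_2=\deg\mathcal G$. -/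

import Mathlib

open scoped PowerSeries LinearAlgebra.Projectivization

/-- A projective geometrically irreducible plane curve of degree `degree` defined over the field
`K`: a homogeneous polynomial in three variables with coefficients in `K` which is irreducible
over an algebraic closure of `K`. -/
structure PlaneCurve (K : Type*) [Field K] where
  degree : ℕ
  poly : MvPolynomial (Fin 3) K
  isHomogeneous : poly.IsHomogeneous degree
  geomIrreducible :
    Irreducible (MvPolynomial.map (algebraMap K (AlgebraicClosure K)) poly)

namespace PlaneCurve

variable {K : Type*} [Field K]

/-- The defining polynomial is irreducible over `K` itself. -/
theorem irreducible_poly (F : PlaneCurve K) : Irreducible F.poly := by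
  have hinj : Function.Injective
      (MvPolynomial.map (σ := Fin 3) (algebraMap K (AlgebraicClosure K))) :=
    MvPolynomial.map_injective _ (algebraMap K (AlgebraicClosure K)).injective
  have hloc : IsLocalHom
      (MvPolynomial.map (σ := Fin 3) (algebraMap K (AlgebraicClosure K))) := by
    refine ⟨fun p hp => ?_⟩
    rw [MvPolynomial.isUnit_iff] at hp ⊢
    refine ⟨?_, fun i hi => ?_⟩
    · have h1 := hp.1
      rw [MvPolynomial.coeff_map, isUnit_iff_ne_zero] at h1
      rw [isUnit_iff_ne_zero]
      intro h0
      exact h1 (by rw [h0, map_zero])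
    · have h2 := hp.2 i hi
      rw [MvPolynomial.coeff_map, isNilpotent_iff_eq_zero, map_eq_zero] at h2
      rw [h2]
      exact IsNilpotent.zero
  exact Irreducible.of_map F.geomIrreducible

/-- The homogeneous coordinate ring `K[X₀, X₁, X₂] / (F)`. -/
abbrev coordRing (F : PlaneCurve K) : Type _ :=
  MvPolynomial (Fin 3) K ⧸ Ideal.span {F.poly}

instance isPrime_span (F : PlaneCurve K) : (Ideal.span {F.poly}).IsPrime :=
  (Ideal.span_singleton_prime F.irreducible_poly.ne_zero).2 F.irreducible_poly.prime

/-- The class of the coordinate `Xᵢ`, in the fraction field of the homogeneous coordinate ring. -/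
noncomputable def coord (F : PlaneCurve K) (i : Fin 3) : FractionRing F.coordRing :=
  algebraMap F.coordRing (FractionRing F.coordRing)
    (Ideal.Quotient.mk (Ideal.span {F.poly}) (MvPolynomial.X i))

/-- The function field `K(F)`: the subfield of the fraction field of the homogeneous coordinate
ring generated over `K` by the quotients of coordinates `xᵢ / xⱼ` (where `xⱼ ≠ 0`; for `xⱼ = 0`
the quotient is `0` by convention and contributes nothing). -/
noncomputable def functionField (F : PlaneCurve K) :
    IntermediateField K (FractionRing F.coordRing) :=
  IntermediateField.adjoin K (Set.range fun ij : Fin 3 × Fin 3 => F.coord ij.1 / F.coord ij.2)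

/-- `G` is a plane model of `F` (over `K`): the two plane curves are birationally equivalent
over `K`, that is, their function fields are isomorphic over `K`. -/
def IsPlaneModelOf (G F : PlaneCurve K) : Prop :=
  Nonempty (F.functionField ≃ₐ[K] G.functionField)

/-- The equation of `F` in the affine chart `Xᵢ ≠ 0`, translated so that the point
`(v₀ : v₁ : v₂)` (with `vᵢ ≠ 0`) becomes the origin of the chart: substitute `Xᵢ = 1` and
`Xⱼ ↦ Xⱼ + vⱼ / vᵢ` for `j ≠ i`. -/
noncomputable def localEquation (F : PlaneCurve K) (v : Fin 3 → K) (i : Fin 3) :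
    MvPolynomial (Fin 3) K :=
  MvPolynomial.aeval
    (fun j => if j = i then 1 else MvPolynomial.X j + MvPolynomial.C (v j / v i)) F.poly

/-- The multiplicity `m_P(F)` of a `K`-rational point `P` of the plane on `F`: the least degree of
a nonzero homogeneous component of the local equation of `F` at `P`. (It does not depend on the
representative of `P` nor on the affine chart containing `P`.) -/
noncomputable def multiplicity (F : PlaneCurve K) (P : ℙ K (Fin 3 → K)) : ℕ :=
  sInf {n | ∃ i, P.rep i ≠ 0 ∧
    MvPolynomial.homogeneousComponent n (F.localEquation P.rep i) ≠ 0}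

/-- Property (H): there are two distinct `K`-rational singular points (points of multiplicity at
least `2`) whose multiplicities add up to the degree. -/
def SatisfiesH (F : PlaneCurve K) : Prop :=
  ∃ P₁ P₂ : ℙ K (Fin 3 → K), P₁ ≠ P₂ ∧ 2 ≤ F.multiplicity P₁ ∧ 2 ≤ F.multiplicity P₂ ∧
    F.multiplicity P₁ + F.multiplicity P₂ = F.degree

/-- A primitive branch representation of `F` with coefficients in `K`: a point
`(x₀(t) : x₁(t) : x₂(t))` of the plane, in special coordinates, which lies on `F`, is not constant,
and cannot be written in terms of a power series `s(t)` of order at least `2`. -/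
structure BranchRep (F : PlaneCurve K) where
  x : Fin 3 → K⟦X⟧
  /-- the coordinates are special: their minimal order is zero -/
  special : ∃ j, PowerSeries.constantCoeff (x j) ≠ 0
  /-- the point lies on the curve -/
  onCurve : MvPolynomial.aeval x F.poly = 0
  /-- the point is not a constant point `(c₀ : c₁ : c₂)` -/
  nonconstant : ¬ ∃ (c : Fin 3 → K) (g : K⟦X⟧), ∀ j, x j = g * PowerSeries.C (c j)
  /-- the representation is primitive -/
  primitive : ¬ ∃ (s g : K⟦X⟧) (y : Fin 3 → K⟦X⟧),
    (PowerSeries.X : K⟦X⟧) ^ 2 ∣ s ∧ ∀ j, x j = g * (y j).subst s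

/-- Two branch representations are equivalent if they differ by a proportionality factor and a
change of the parameter `t ↦ s(t)` with `s` of order exactly `1`. -/
def BranchRep.Equivalent {F : PlaneCurve K} (a b : F.BranchRep) : Prop :=
  ∃ s g : K⟦X⟧, PowerSeries.constantCoeff s = 0 ∧ PowerSeries.coeff 1 s ≠ 0 ∧
    ∀ j, a.x j = g * (b.x j).subst s

theorem BranchRep.equivalence (F : PlaneCurve K) :
    Equivalence (BranchRep.Equivalent (F := F)) := by
  refine ⟨fun a => ?_, fun {a b} h => ?_, fun {a b c} hab hbc => ?_⟩
  · refine ⟨PowerSeries.X, 1, by simp, by simp, fun j => ?_⟩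
    rw [PowerSeries.X_subst, one_mul]
  · obtain ⟨s, g, hs0, hs1, h⟩ := h
    have hu : IsUnit (PowerSeries.coeff 1 s) := isUnit_iff_ne_zero.2 hs1
    have hg : PowerSeries.constantCoeff g ≠ 0 := by
      obtain ⟨j, hj⟩ := a.special
      intro h0
      apply hj
      rw [h j, map_mul, h0, zero_mul]
    have hgi : g⁻¹ * g = 1 := PowerSeries.inv_mul_cancel g hg
    have hS : PowerSeries.HasSubst s := PowerSeries.HasSubst.of_constantCoeff_zero' hs0
    have hT : PowerSeries.HasSubst (s.substInvOfIsUnit hu) :=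
      PowerSeries.HasSubst.substInvOfIsUnit s hu
    refine ⟨s.substInvOfIsUnit hu, (g⁻¹).subst (s.substInvOfIsUnit hu),
      PowerSeries.constantCoeff_substInvOfIsUnit s hu, ?_, fun j => ?_⟩
    · rw [PowerSeries.coeff_one_substInvOfIsUnit]
      exact Units.ne_zero _
    · rw [h j, ← PowerSeries.subst_mul hT, ← mul_assoc, hgi, one_mul,
        PowerSeries.subst_comp_subst_apply hS hT,
        PowerSeries.subst_substInvOfIsUnit_right s hs0 hu, PowerSeries.X_subst]
  · obtain ⟨s, g, hs0, hs1, h⟩ := hab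
    obtain ⟨r, k, hr0, hr1, h'⟩ := hbc
    have hS : PowerSeries.HasSubst s := PowerSeries.HasSubst.of_constantCoeff_zero' hs0
    have hR : PowerSeries.HasSubst r := PowerSeries.HasSubst.of_constantCoeff_zero' hr0
    have hc : ∀ f : K⟦X⟧, PowerSeries.constantCoeff (f.subst s : K⟦X⟧)
        = PowerSeries.constantCoeff f := by
      intro f
      obtain ⟨q, hq⟩ : PowerSeries.X ∣ f - PowerSeries.C (PowerSeries.constantCoeff f) :=
        PowerSeries.X_dvd_iff.2 (by simp)
      have hf : f = PowerSeries.X * q + PowerSeries.C (PowerSeries.constantCoeff f) := by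
        rw [← hq]; ring
      have hC : ((PowerSeries.C (PowerSeries.constantCoeff f)).subst s : K⟦X⟧)
          = PowerSeries.C (PowerSeries.constantCoeff f) := PowerSeries.subst_C _
      have h1 : (f.subst s : K⟦X⟧)
          = s * q.subst s + PowerSeries.C (PowerSeries.constantCoeff f) := by
        conv_lhs => rw [hf]
        rw [PowerSeries.subst_add hS, PowerSeries.subst_mul hS, PowerSeries.subst_X hS, hC]
      rw [h1, map_add, map_mul, hs0, zero_mul, zero_add, PowerSeries.constantCoeff_C]
    have hcomp : ∃ q : K⟦X⟧, (r.subst s : K⟦X⟧) = s * q ∧ PowerSeries.constantCoeff q ≠ 0 := by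
      obtain ⟨r', hr'⟩ := PowerSeries.X_dvd_iff.2 hr0
      refine ⟨r'.subst s, ?_, ?_⟩
      · rw [hr', PowerSeries.subst_mul hS, PowerSeries.subst_X hS]
      · rw [hc]
        have := PowerSeries.coeff_succ_X_mul 0 r'
        rw [← hr', PowerSeries.coeff_zero_eq_constantCoeff_apply] at this
        rw [← this]
        exact hr1
    obtain ⟨q, hq, hq0⟩ := hcomp
    refine ⟨r.subst s, g * k.subst s, ?_, ?_, fun j => ?_⟩
    · rw [hc, hr0]
    · obtain ⟨s', hs'⟩ := PowerSeries.X_dvd_iff.2 hs0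
      have h1 := PowerSeries.coeff_succ_X_mul 0 s'
      have h2 := PowerSeries.coeff_succ_X_mul 0 (s' * q)
      rw [← hs', PowerSeries.coeff_zero_eq_constantCoeff_apply] at h1
      rw [← mul_assoc, ← hs', ← hq, PowerSeries.coeff_zero_eq_constantCoeff_apply, map_mul,
        ← h1] at h2
      rw [h2]
      exact mul_ne_zero hs1 hq0
    · rw [h j, h' j, PowerSeries.subst_mul hS, PowerSeries.subst_comp_subst_apply hR hS, mul_assoc]

/-- Equivalence of primitive branch representations, as a setoid. -/
instance branchSetoid (F : PlaneCurve K) : Setoid F.BranchRep :=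
  ⟨BranchRep.Equivalent, BranchRep.equivalence F⟩

/-- The branches of `F` defined over `K`: equivalence classes of primitive branch representations
with coefficients in `K`. -/
def RationalBranch (F : PlaneCurve K) : Type _ :=
  Quotient F.branchSetoid

end PlaneCurve

/-! Every plane curve has a plane model with property (H), over any field; rational branches are not
needed. In affine coordinates (H) for the two coordinate points says that the bidegree `(a, b)` of
the equation satisfies `a, b ≥ 2` and that the monomial `x ^ a * y ^ b` occurs. For a curve that is
not a coordinate line, a unimodular transformation of the exponents moves a vertex of the Newton
polygon to that corner; a coordinate line is first replaced by the line `Xᵢ + Xⱼ = 0`. -/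

/-! A monomial substitution whose exponent map is unimodular and preserves degrees does not change
the function field, and it moves the Newton polygon by an affine map. Multiplicities at coordinate
points can be read off that polygon: at the `i`-th point the multiplicity is the degree of the
equation minus its degree in `Xᵢ` (`multiplicity_coordPoint`). So (H) at two coordinate points asks
for one monomial, free of the third variable, in which both exponents are maximal and at least 2.

To produce it, take a vertex `v` with `v 1 = 0` that alone minimises `u = e 0 + n * e 1` on the
support. New exponents of the form `A - (3u + e 1)` and `B - (2u + e 1)` are then both largest at
`v`. The equation is not a monomial, so `u` grows by at least 1 elsewhere, which makes the two
maxima at least 3 and 2 (`exists_model_of_not_X_dvd`).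

Two facts justify the substitution. Irreducibility passes through the Laurent ring, where monomials
are units: for polynomials without a variable as factor nothing is lost (`prime_ofPoly`,
`irreducible_of_prime_ofPoly`). The function field is generated by Laurent monomials of degree zero,
and the exponent map permutes these (`adjoin_ratios`, `isPlaneModelOf_of_isMonomialTransform`). -/

/-- The ring of Laurent polynomials in three variables. -/
abbrev LaurentThree (k : Type*) [Field k] := AddMonoidAlgebra k (Fin 3 → ℤ)

/-! ### Divisibility and primality in polynomial and Laurent rings -/

namespace LaurentThree

variable {k : Type*} [Field k]

/-- Exponents in `ℕ`, viewed as exponents in `ℤ`. -/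
def castExp : (Fin 3 →₀ ℕ) →+ (Fin 3 → ℤ) where
  toFun e i := (e i : ℤ)
  map_zero' := by ext; simp
  map_add' a b := by ext; simp

@[simp] theorem castExp_apply (e : Fin 3 →₀ ℕ) (i : Fin 3) : castExp e i = e i := rfl

theorem castExp_injective : Function.Injective castExp := fun a b h => by
  ext i
  have := congrFun h i
  simpa using this

theorem exists_castExp {e : Fin 3 → ℤ} (h : ∀ i, 0 ≤ e i) : ∃ a, castExp a = e :=
  ⟨Finsupp.equivFunOnFinite.symm fun i => (e i).toNat, by ext i; simp [h i]⟩

/-- The inclusion of polynomials in Laurent polynomials. -/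
noncomputable def ofPoly : MvPolynomial (Fin 3) k →ₐ[k] LaurentThree k :=
  AddMonoidAlgebra.mapDomainAlgHom k k castExp

/-- The Laurent monomial with exponent `e`. -/
noncomputable def mono (k : Type*) [Field k] (e : Fin 3 → ℤ) : LaurentThree k :=
  AddMonoidAlgebra.single e 1

theorem mono_add (a b : Fin 3 → ℤ) : mono k (a + b) = mono k a * mono k b := by
  simp [mono, AddMonoidAlgebra.single_mul_single]

theorem mono_zero : mono k 0 = 1 := rfl

theorem mono_neg_mul (a : Fin 3 → ℤ) : mono k (-a) * mono k a = 1 := by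
  rw [← mono_add, neg_add_cancel, mono_zero]

theorem isUnit_mono (a : Fin 3 → ℤ) : IsUnit (mono k a) :=
  IsUnit.of_mul_eq_one_right _ (mono_neg_mul a)

theorem coeff_ofPoly (p : MvPolynomial (Fin 3) k) (e : Fin 3 →₀ ℕ) :
    (ofPoly p).coeff (castExp e) = p.coeff e :=
  Finsupp.mapDomain_apply castExp_injective _ _

theorem coeff_ofPoly_eq_zero {p : MvPolynomial (Fin 3) k} {a : Fin 3 → ℤ}
    (h : ¬ ∃ e, castExp e = a) : (ofPoly p).coeff a = 0 :=
  Finsupp.mapDomain_of_notMem_range _ _ fun ⟨e, he⟩ => h ⟨e, he⟩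

theorem coeff_ofPoly_ne_zero {p : MvPolynomial (Fin 3) k} {a : Fin 3 → ℤ}
    (h : (ofPoly p).coeff a ≠ 0) : ∃ e, castExp e = a ∧ p.coeff e ≠ 0 := by
  obtain ⟨e, rfl⟩ := not_imp_comm.1 coeff_ofPoly_eq_zero h
  exact ⟨e, rfl, by rwa [coeff_ofPoly] at h⟩

theorem ofPoly_injective : Function.Injective (ofPoly (k := k)) := fun p q h => by
  ext e
  rw [← coeff_ofPoly, ← coeff_ofPoly, h]

theorem ofPoly_monomial (e : Fin 3 →₀ ℕ) (c : k) :
    ofPoly (MvPolynomial.monomial e c) = AddMonoidAlgebra.single (castExp e) c :=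
  AddMonoidAlgebra.mapDomain_single

theorem ofPoly_monomial_one (e : Fin 3 →₀ ℕ) :
    ofPoly (MvPolynomial.monomial e (1 : k)) = mono k (castExp e) := ofPoly_monomial e 1

theorem exists_ofPoly {f : LaurentThree k} (h : ∀ a, f.coeff a ≠ 0 → ∀ i, 0 ≤ a i) :
    ∃ p, ofPoly p = f := by
  have hf : f = f.coeff.sum fun a c => AddMonoidAlgebra.single a c := by
    exact (AddMonoidAlgebra.sum_coeff_single f).symm
  suffices H : f ∈ (ofPoly (k := k)).range from H
  rw [hf]
  refine Subalgebra.sum_mem _ fun a ha => ?_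
  obtain ⟨e, rfl⟩ := exists_castExp (h a (Finsupp.mem_support_iff.1 ha))
  exact ⟨MvPolynomial.monomial e (f.coeff (castExp e)), ofPoly_monomial _ _⟩

theorem coeff_mono_mul (s a : Fin 3 → ℤ) (f : LaurentThree k) :
    (mono k s * f).coeff a = f.coeff (a - s) := by
  rw [mono, AddMonoidAlgebra.coeff_single_mul_eq_mul_coeff (a - s)
    (fun b _ => by rw [eq_sub_iff_add_eq']), one_mul]

theorem exists_mono_mul (f : LaurentThree k) :
    ∃ (s : Fin 3 →₀ ℕ) (p : MvPolynomial (Fin 3) k), mono k (castExp s) * f = ofPoly p := by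
  classical
  -- The largest pole order in each variable, and 0 if there is no pole.
  let s : Fin 3 →₀ ℕ := Finsupp.equivFunOnFinite.symm fun i =>
    f.coeff.support.sup fun a => (-(a i)).toNat
  obtain ⟨p, hp⟩ := exists_ofPoly (f := mono k (castExp s) * f) (by
    intro a ha i
    rw [coeff_mono_mul] at ha
    have h1 : (-((a - castExp s) i)).toNat ≤ s i :=
      Finset.le_sup (f := fun a : Fin 3 → ℤ => (-(a i)).toNat) (Finsupp.mem_support_iff.2 ha)
    have h2 : (a - castExp s) i = a i - s i := rfl
    omega)
  exact ⟨s, p, hp.symm⟩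

theorem not_dvd_monomial {p : MvPolynomial (Fin 3) k} (hp : Prime p)
    (hX : ∀ i, ¬ MvPolynomial.X i ∣ p) (s : Fin 3 →₀ ℕ) :
    ¬ p ∣ MvPolynomial.monomial s 1 := by
  intro h
  rw [MvPolynomial.monomial_eq, map_one, one_mul, Finsupp.prod] at h
  obtain ⟨i, _, hi⟩ := hp.exists_mem_finset_dvd h
  have h1 := hp.dvd_of_dvd_pow hi
  exact hX i ((hp.irreducible.associated_of_dvd (MvPolynomial.X_prime (i := i)).irreducible h1).symm.dvd)

/-- A monomial clears the denominators of the quotient; a prime other than the variables divides no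
monomial, so it divides the remaining factor. -/
theorem dvd_of_ofPoly_dvd {p q : MvPolynomial (Fin 3) k} (hp : Prime p)
    (hX : ∀ i, ¬ MvPolynomial.X i ∣ p) (h : ofPoly p ∣ ofPoly q) : p ∣ q := by
  obtain ⟨f, hf⟩ := h
  obtain ⟨s, r, hr⟩ := exists_mono_mul f
  have h1 : MvPolynomial.monomial s 1 * q = p * r := by
    apply ofPoly_injective
    rw [map_mul, map_mul, ofPoly_monomial_one, hf, ← hr]
    ring
  exact (hp.dvd_or_dvd (Dvd.intro _ h1.symm)).resolve_left (not_dvd_monomial hp hX s)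

theorem prime_ofPoly {p : MvPolynomial (Fin 3) k} (hp : Prime p)
    (hX : ∀ i, ¬ MvPolynomial.X i ∣ p) : Prime (ofPoly p) := by
  refine ⟨fun h => hp.ne_zero (ofPoly_injective (by rw [h, map_zero])), fun h => ?_,
    fun f g h => ?_⟩
  · have h1 : ofPoly p ∣ ofPoly 1 := h.dvd
    exact hp.not_isUnit (isUnit_of_dvd_one (dvd_of_ofPoly_dvd hp hX h1))
  · obtain ⟨s, a, ha⟩ := exists_mono_mul f
    obtain ⟨t, b, hb⟩ := exists_mono_mul g
    have h1 : ofPoly p ∣ ofPoly (a * b) := by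
      rw [map_mul, ← ha, ← hb, mul_mul_mul_comm]
      exact h.mul_left _
    rcases hp.dvd_or_dvd (dvd_of_ofPoly_dvd hp hX h1) with h2 | h2
    · left
      have := map_dvd ofPoly h2
      rwa [← ha, (isUnit_mono _).dvd_mul_left] at this
    · right
      have := map_dvd ofPoly h2
      rwa [← hb, (isUnit_mono _).dvd_mul_left] at this

/-- A polynomial without monomial factors is irreducible as soon as it is prime as a Laurent
polynomial. -/
theorem irreducible_of_prime_ofPoly {q : MvPolynomial (Fin 3) k} (hq : Prime (ofPoly q))
    (hX : ∀ i, ¬ MvPolynomial.X i ∣ q) : Irreducible q := by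
  have key : ∀ a b, q = a * b → ofPoly q ∣ ofPoly a → IsUnit b := by
    rintro a b rfl ⟨f, hf⟩
    have ha : ofPoly a ≠ 0 := fun h => hq.ne_zero (by rw [map_mul, h, zero_mul])
    rw [map_mul, mul_assoc] at hf
    have h1 : ofPoly b * f = 1 := mul_left_cancel₀ ha (by rw [← hf, mul_one])
    obtain ⟨s, r, hr⟩ := exists_mono_mul f
    -- A Laurent unit divides a monomial; as no variable divides `b`, it is also relatively prime to
    -- that monomial, hence a unit.
    have h2 : b ∣ MvPolynomial.monomial s 1 := by
      refine ⟨r, ofPoly_injective ?_⟩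
      rw [map_mul, ← hr, ofPoly_monomial_one, mul_left_comm, h1, mul_one]
    have h3 : IsRelPrime b (MvPolynomial.monomial s 1) := by
      rw [MvPolynomial.monomial_eq, map_one, one_mul, Finsupp.prod]
      refine IsRelPrime.prod_right fun i _ => IsRelPrime.pow_right ?_
      exact (((MvPolynomial.X_prime (i := i)).irreducible.isRelPrime_iff_not_dvd).2
        fun h => hX i (h.mul_left a)).symm
    exact h3.isUnit_of_dvd h2
  refine ⟨fun h => hq.not_isUnit (h.map ofPoly), fun a b hab => ?_⟩
  have h1 : ofPoly q ∣ ofPoly a * ofPoly b := by rw [hab, map_mul]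
  rcases hq.dvd_or_dvd h1 with h | h
  · exact Or.inr (key a b hab h)
  · exact Or.inl (key b a (by rw [hab, mul_comm]) h)

/-! ### Monomial transformations -/

/-- The automorphism of the Laurent polynomial ring given by an automorphism of the lattice of
exponents. -/
noncomputable def congrExp (M : (Fin 3 → ℤ) ≃+ (Fin 3 → ℤ)) : LaurentThree k ≃ₐ[k] LaurentThree k :=
  AddMonoidAlgebra.domCongr k k M

theorem congrExp_mono (M : (Fin 3 → ℤ) ≃+ (Fin 3 → ℤ)) (a : Fin 3 → ℤ) :
    congrExp M (mono k a) = mono k (M a) := by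
  simp [congrExp, mono]

/-- `G` arises from `F` by the monomial substitution with exponents transformed by `e ↦ s + M e`. -/
def IsMonomialTransform (M : (Fin 3 → ℤ) ≃+ (Fin 3 → ℤ)) (s : Fin 3 → ℤ)
    (F G : MvPolynomial (Fin 3) k) : Prop :=
  ofPoly G = mono k s * congrExp M (ofPoly F)

variable {M : (Fin 3 → ℤ) ≃+ (Fin 3 → ℤ)} {s : Fin 3 → ℤ} {F G : MvPolynomial (Fin 3) k}

theorem coeff_transform (a : Fin 3 → ℤ) :
    (mono k s * congrExp M (ofPoly F)).coeff a = (ofPoly F).coeff (M.symm (a - s)) := by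
  rw [coeff_mono_mul]
  exact AddMonoidAlgebra.coeff_domCongr ..

theorem exists_isMonomialTransform
    (h : ∀ e, F.coeff e ≠ 0 → ∀ i, 0 ≤ (s + M (castExp e)) i) :
    ∃ G, IsMonomialTransform M s F G := by
  refine exists_ofPoly fun a ha => ?_
  rw [coeff_transform] at ha
  obtain ⟨e, he, hc⟩ := coeff_ofPoly_ne_zero ha
  have h1 := h e hc
  rwa [he, AddEquiv.apply_symm_apply, add_sub_cancel] at h1

theorem IsMonomialTransform.coeff_ne_zero (h : IsMonomialTransform M s F G) {a : Fin 3 →₀ ℕ}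
    (ha : G.coeff a ≠ 0) : ∃ e, F.coeff e ≠ 0 ∧ castExp a = s + M (castExp e) := by
  rw [← coeff_ofPoly, h, coeff_transform] at ha
  obtain ⟨e, he, hc⟩ := coeff_ofPoly_ne_zero ha
  exact ⟨e, hc, by rw [he, AddEquiv.apply_symm_apply, add_sub_cancel]⟩

theorem IsMonomialTransform.coeff_eq (h : IsMonomialTransform M s F G) {a e : Fin 3 →₀ ℕ}
    (ha : castExp a = s + M (castExp e)) : G.coeff a = F.coeff e := by
  rw [← coeff_ofPoly, h, coeff_transform, ha, add_sub_cancel_left, AddEquiv.symm_apply_apply,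
    coeff_ofPoly]

theorem IsMonomialTransform.irreducible (h : IsMonomialTransform M s F G) (hF : Irreducible F)
    (hFX : ∀ i, ¬ MvPolynomial.X i ∣ F) (hGX : ∀ i, ¬ MvPolynomial.X i ∣ G) : Irreducible G := by
  refine irreducible_of_prime_ofPoly ?_ hGX
  rw [h, Associated.prime_iff (associated_unit_mul_left _ _ (isUnit_mono s))]
  exact (MulEquiv.prime_iff (congrExp M)).2 (prime_ofPoly hF.prime hFX)

/-- Needed because geometric irreducibility is tested over the algebraic closure. -/
theorem IsMonomialTransform.map {L : Type*} [Field L] (f : k →+* L)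
    (h : IsMonomialTransform M s F G) :
    IsMonomialTransform M s (MvPolynomial.map f F) (MvPolynomial.map f G) := by
  have hcoe : ∀ (p : MvPolynomial (Fin 3) k) a,
      (ofPoly (MvPolynomial.map f p)).coeff a = f ((ofPoly p).coeff a) := by
    intro p a
    by_cases ha : ∃ e, castExp e = a
    · obtain ⟨e, rfl⟩ := ha
      rw [coeff_ofPoly, coeff_ofPoly, MvPolynomial.coeff_map]
    · rw [coeff_ofPoly_eq_zero ha, coeff_ofPoly_eq_zero ha, map_zero]
  unfold IsMonomialTransform
  ext a
  rw [hcoe, h, coeff_transform, coeff_transform, hcoe]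

end LaurentThree

/-! ### Evaluation at points of a torus -/

namespace LaurentThree

variable {k : Type*} [Field k] {L : Type*} [Field L] [Algebra k L]

/-- Evaluation of Laurent polynomials at nonzero elements of a field. -/
noncomputable def eval (x : Fin 3 → Lˣ) : LaurentThree k →ₐ[k] L :=
  AddMonoidAlgebra.lift k L (Fin 3 → ℤ) <| (Units.coeHom L).comp
    { toFun := fun e => ∏ i, x i ^ (e.toAdd i)
      map_one' := by simp
      map_mul' := fun a b => by simp [zpow_add, Finset.prod_mul_distrib] }

theorem eval_mono (x : Fin 3 → Lˣ) (e : Fin 3 → ℤ) :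
    eval x (mono k e) = ((∏ i, x i ^ e i : Lˣ) : L) := by
  simp [eval, mono]

theorem eval_mono_single (x : Fin 3 → Lˣ) (i : Fin 3) :
    eval x (mono k (Pi.single i 1)) = x i := by
  rw [eval_mono, Finset.prod_eq_single i]
  · simp
  · intro j _ hj
    simp [hj]
  · simp

theorem ofPoly_X (i : Fin 3) :
    ofPoly (MvPolynomial.X i : MvPolynomial (Fin 3) k) = mono k (Pi.single i 1) := by
  rw [MvPolynomial.X, ofPoly_monomial_one]
  congr 1
  ext j
  by_cases h : j = i
  · subst h
    simp
  · simp [h]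

theorem algHom_ofPoly (ψ : LaurentThree k →ₐ[k] L) (p : MvPolynomial (Fin 3) k) :
    ψ (ofPoly p) = MvPolynomial.aeval (fun i => ψ (mono k (Pi.single i 1))) p := by
  have : ψ.comp ofPoly = MvPolynomial.aeval (fun i => ψ (mono k (Pi.single i 1))) :=
    MvPolynomial.algHom_ext fun i => by simp [ofPoly_X]
  exact DFunLike.congr_fun this p

/-- The field generated by the ratios of the coordinates consists of the monomials of degree
zero. -/
theorem adjoin_ratios (ψ : LaurentThree k →ₐ[k] L) :
    IntermediateField.adjoin k (Set.range fun ij : Fin 3 × Fin 3 =>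
      ψ (mono k (Pi.single ij.1 1)) / ψ (mono k (Pi.single ij.2 1))) =
    IntermediateField.adjoin k {y | ∃ e : Fin 3 → ℤ, ∑ i, e i = 0 ∧ ψ (mono k e) = y} := by
  have hneg : ∀ a, ψ (mono k (-a)) = (ψ (mono k a))⁻¹ := fun a =>
    eq_inv_of_mul_eq_one_left (by rw [← map_mul, mono_neg_mul, map_one])
  have hsub : ∀ a b, ψ (mono k (a - b)) = ψ (mono k a) / ψ (mono k b) := fun a b => by
    rw [sub_eq_add_neg, mono_add, map_mul, hneg, div_eq_mul_inv]
  apply le_antisymm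
  · refine IntermediateField.adjoin_le_iff.2 ?_
    rintro _ ⟨⟨i, j⟩, rfl⟩
    refine IntermediateField.subset_adjoin _ _ ⟨Pi.single i 1 - Pi.single j 1, ?_, hsub _ _⟩
    simp
  · refine IntermediateField.adjoin_le_iff.2 ?_
    rintro _ ⟨e, he, rfl⟩
    set E := IntermediateField.adjoin k (Set.range fun ij : Fin 3 × Fin 3 =>
      ψ (mono k (Pi.single ij.1 1)) / ψ (mono k (Pi.single ij.2 1))) with hE
    -- Exponents whose monomial lies in `E` form a subgroup, and differences of basis vectors
    -- generate the lattice of degree zero.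
    let S : AddSubgroup (Fin 3 → ℤ) :=
      { carrier := {a | ψ (mono k a) ∈ E}
        zero_mem' := by
          change ψ (mono k 0) ∈ E
          rw [mono_zero, map_one]
          exact E.one_mem
        add_mem' := fun {a b} ha hb => by
          change ψ (mono k (a + b)) ∈ E
          rw [mono_add, map_mul]
          exact E.mul_mem ha hb
        neg_mem' := fun {a} ha => by
          change ψ (mono k (-a)) ∈ E
          rw [hneg]
          exact E.inv_mem ha }
    have hS : ∀ i j : Fin 3, (Pi.single i 1 - Pi.single j 1 : Fin 3 → ℤ) ∈ S := fun i j => by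
      change ψ (mono k _) ∈ E
      rw [hsub]
      exact IntermediateField.subset_adjoin _ _ ⟨(i, j), rfl⟩
    have h1 : e = e 0 • (Pi.single 0 1 - Pi.single 2 1 : Fin 3 → ℤ) +
        e 1 • (Pi.single 1 1 - Pi.single 2 1 : Fin 3 → ℤ) := by
      rw [Fin.sum_univ_three] at he
      ext i
      fin_cases i <;> simp
      omega
    change e ∈ S
    rw [h1]
    exact S.add_mem (S.zsmul_mem (hS _ _) _) (S.zsmul_mem (hS _ _) _)

end LaurentThree

/-! ### Plane models from generic points -/

namespace PlaneCurve

variable {K : Type*} [Field K]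

/-- A generic point of `G` with coordinates in the field of `F` whose ratios generate the function
field of `F` makes `G` a plane model of `F`. -/
theorem isPlaneModelOf_of_generic {F G : PlaneCurve K} (z : Fin 3 → FractionRing F.coordRing)
    (hz : MvPolynomial.aeval z G.poly = 0)
    (hker : ∀ p : MvPolynomial (Fin 3) K, MvPolynomial.aeval z p = 0 → G.poly ∣ p)
    (hadj : IntermediateField.adjoin K (Set.range fun ij : Fin 3 × Fin 3 => z ij.1 / z ij.2) =
      F.functionField) : G.IsPlaneModelOf F := by
  -- The kernel of evaluation at `z` is exactly the ideal of `G`, so the coordinate ring embeds. The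
  -- induced map of fraction fields need not be onto; only the ratios matter.
  let φ : G.coordRing →ₐ[K] FractionRing F.coordRing :=
    Ideal.Quotient.liftₐ _ (MvPolynomial.aeval z) fun p hp => by
      obtain ⟨q, rfl⟩ := Ideal.mem_span_singleton.1 hp
      rw [map_mul, hz, zero_mul]
  have hφ : Function.Injective φ := by
    rw [injective_iff_map_eq_zero]
    intro a ha
    obtain ⟨p, rfl⟩ := Ideal.Quotient.mk_surjective a
    exact Ideal.Quotient.eq_zero_iff_mem.2 (Ideal.mem_span_singleton.2 (hker p ha))
  let Φ : FractionRing G.coordRing →ₐ[K] FractionRing F.coordRing :=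
    IsFractionRing.liftAlgHom hφ
  have hΦ : ∀ i, Φ (G.coord i) = z i := fun i => by
    have h1 : Φ (G.coord i) = φ (Ideal.Quotient.mk (Ideal.span {G.poly}) (MvPolynomial.X i)) :=
      IsFractionRing.lift_algebraMap hφ _
    rw [h1]
    exact MvPolynomial.aeval_X z i
  have hmap : G.functionField.map Φ = F.functionField := by
    rw [functionField, IntermediateField.adjoin_map, ← Set.range_comp, ← hadj]
    congr 2
    ext ij
    simp [hΦ]
  exact ⟨((G.functionField.equivMap Φ).trans (IntermediateField.equivOfEq hmap)).symm⟩

theorem aeval_coord (F : PlaneCurve K) (p : MvPolynomial (Fin 3) K) :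
    MvPolynomial.aeval F.coord p = algebraMap F.coordRing (FractionRing F.coordRing)
      (Ideal.Quotient.mk (Ideal.span {F.poly}) p) := by
  have : MvPolynomial.aeval F.coord = (IsScalarTower.toAlgHom K F.coordRing
      (FractionRing F.coordRing)).comp (Ideal.Quotient.mkₐ K (Ideal.span {F.poly})) :=
    MvPolynomial.algHom_ext fun i => by simp [coord]
  rw [this]
  rfl

theorem aeval_coord_eq_zero_iff (F : PlaneCurve K) (p : MvPolynomial (Fin 3) K) :
    MvPolynomial.aeval F.coord p = 0 ↔ F.poly ∣ p := by
  rw [aeval_coord, map_eq_zero_iff _ (IsFractionRing.injective _ _),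
    Ideal.Quotient.eq_zero_iff_mem, Ideal.mem_span_singleton]

theorem poly_not_dvd_X {F : PlaneCurve K} (hX : ∀ i, ¬ MvPolynomial.X i ∣ F.poly) (i : Fin 3) :
    ¬ F.poly ∣ MvPolynomial.X i := fun h =>
  hX i (F.irreducible_poly.associated_of_dvd
    (MvPolynomial.X_prime (i := i)).irreducible h).symm.dvd

theorem coord_ne_zero {F : PlaneCurve K} (hX : ∀ i, ¬ MvPolynomial.X i ∣ F.poly) (i : Fin 3) :
    F.coord i ≠ 0 := fun h => by
  refine poly_not_dvd_X hX i ((F.aeval_coord_eq_zero_iff _).1 ?_)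
  rw [MvPolynomial.aeval_X, h]

open LaurentThree in
/-- A degree preserving monomial transformation yields a plane model. -/
theorem isPlaneModelOf_of_isMonomialTransform {F G : PlaneCurve K}
    {M : (Fin 3 → ℤ) ≃+ (Fin 3 → ℤ)} {s : Fin 3 → ℤ} (hM : ∀ e, ∑ i, M e i = ∑ i, e i)
    (hFX : ∀ i, ¬ MvPolynomial.X i ∣ F.poly) (hGX : ∀ i, ¬ MvPolynomial.X i ∣ G.poly)
    (h : IsMonomialTransform M s F.poly G.poly) : G.IsPlaneModelOf F := by
  let x : Fin 3 → (FractionRing F.coordRing)ˣ := fun i => Units.mk0 _ (coord_ne_zero hFX i)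
  let ψ : LaurentThree K →ₐ[K] FractionRing F.coordRing := eval x
  have hψX : (fun i => ψ (mono K (Pi.single i 1))) = F.coord :=
    funext fun i => eval_mono_single x i
  have hψ : ∀ p, ψ (ofPoly p) = 0 ↔ F.poly ∣ p := fun p => by
    rw [algHom_ofPoly, hψX, aeval_coord_eq_zero_iff]
  have hker : ∀ f, ψ f = 0 → ofPoly F.poly ∣ f := fun f hf => by
    obtain ⟨t, p, hp⟩ := exists_mono_mul f
    have h1 : F.poly ∣ p := (hψ p).1 (by rw [← hp, map_mul, hf, mul_zero])
    have h2 := map_dvd ofPoly h1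
    rwa [← hp, (isUnit_mono _).dvd_mul_left] at h2
  -- The new generic point is the old one composed with the inverse substitution. As `G` is a
  -- Laurent unit times the transform of `F`, the kernel of `χ` is generated by `G`.
  let χ : LaurentThree K →ₐ[K] FractionRing F.coordRing :=
    ψ.comp (congrExp M).symm.toAlgHom
  have hχ : ∀ f, χ f = ψ ((congrExp M).symm f) := fun f => rfl
  refine isPlaneModelOf_of_generic (fun i => χ (mono K (Pi.single i 1))) ?_ (fun p hp => ?_) ?_
  · rw [← algHom_ofPoly, h, map_mul, hχ (congrExp M _), AlgEquiv.symm_apply_apply,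
      (hψ _).2 dvd_rfl, mul_zero]
  · rw [← algHom_ofPoly, hχ] at hp
    have h1 := map_dvd (congrExp M) (hker _ hp)
    rw [AlgEquiv.apply_symm_apply] at h1
    refine dvd_of_ofPoly_dvd G.irreducible_poly.prime hGX ?_
    rwa [h, (isUnit_mono s).mul_left_dvd]
  · rw [adjoin_ratios]
    have hF := adjoin_ratios ψ
    simp only [congrFun hψX] at hF
    rw [functionField, hF]
    congr 1
    ext y
    constructor
    · rintro ⟨e, he, rfl⟩
      refine ⟨M.symm e, by rw [← hM, AddEquiv.apply_symm_apply, he], ?_⟩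
      rw [hχ]
      congr 1
      rw [AlgEquiv.eq_symm_apply, congrExp_mono, AddEquiv.apply_symm_apply]
    · rintro ⟨e, he, rfl⟩
      refine ⟨M e, by rw [hM, he], ?_⟩
      rw [hχ, ← congrExp_mono, AlgEquiv.symm_apply_apply]

end PlaneCurve

/-- Reduction modulo `X i` keeps precisely the terms free of `X i`. In this form the condition says
that the Newton polygon meets the face `e i = 0`. -/
theorem MvPolynomial.not_X_dvd_iff {σ R : Type*} [CommRing R] {i : σ} {p : MvPolynomial σ R} :
    ¬ X i ∣ p ↔ ∃ e, p.coeff e ≠ 0 ∧ e i = 0 := by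
  classical
  rw [X_dvd_iff_modMonomial_eq_zero, MvPolynomial.ext_iff, not_forall]
  have hle : ∀ e : σ →₀ ℕ, Finsupp.single i 1 ≤ e ↔ e i ≠ 0 := fun e => by
    rw [Finsupp.single_le_iff, Nat.one_le_iff_ne_zero]
  refine exists_congr fun e => ?_
  by_cases h : e i = 0
  · rw [coeff_modMonomial_of_not_le _ (by rw [hle]; exact not_not.2 h)]
    simp [h]
  · rw [coeff_modMonomial_of_le _ ((hle e).2 h)]
    simp [h]

/-! ### Multiplicities at coordinate points -/

namespace PlaneCurve

variable {K : Type*} [Field K]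

theorem sum_exp {F : PlaneCurve K} {e : Fin 3 →₀ ℕ} (he : F.poly.coeff e ≠ 0) :
    e 0 + e 1 + e 2 = F.degree := by
  have h := F.isHomogeneous he
  rw [← Fin.sum_univ_three]
  simpa [Finsupp.weight_apply, Finsupp.sum_fintype] using h

/-- The translation vanishes here, so only dehomogenisation remains. -/
theorem coeff_localEquation_of_apply_eq_zero (F : PlaneCurve K) {v : Fin 3 → K} {i : Fin 3}
    (hv : ∀ j, j ≠ i → v j = 0) :
    F.localEquation v i =
      ∑ e ∈ F.poly.support, MvPolynomial.monomial (e.erase i) (F.poly.coeff e) := by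
  rw [localEquation, MvPolynomial.aeval_def, MvPolynomial.eval₂_eq']
  refine Finset.sum_congr rfl fun e _ => ?_
  rw [MvPolynomial.monomial_eq, Finsupp.prod_fintype _ _ (fun _ => pow_zero _)]
  congr 1
  refine Finset.prod_congr rfl fun j _ => ?_
  by_cases h : j = i
  · subst h
    simp
  · simp [h, hv j h, Finsupp.erase_ne h]

/-- The coordinate point of the plane at which only the `i`-th coordinate does not vanish. -/
noncomputable def coordPoint (K : Type*) [Field K] (i : Fin 3) : ℙ K (Fin 3 → K) :=
  Projectivization.mk K (Pi.single i 1) (by simp)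

theorem coordPoint_rep (i : Fin 3) :
    (coordPoint K i).rep i ≠ 0 ∧ ∀ j, j ≠ i → (coordPoint K i).rep j = 0 := by
  obtain ⟨a, ha⟩ := Projectivization.exists_smul_eq_mk_rep K (Pi.single i 1 : Fin 3 → K) (by simp)
  rw [coordPoint, ← ha]
  exact ⟨by simp [Units.smul_def], fun j hj => by simp [hj]⟩

theorem coordPoint_injective : Function.Injective (coordPoint K) := fun i j h => by
  by_contra hij
  exact (coordPoint_rep (K := K) i).1 (h ▸ (coordPoint_rep j).2 i hij)

/-- The multiplicity at a coordinate point is the codegree of the polynomial in that variable. -/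
theorem multiplicity_coordPoint (F : PlaneCurve K) (i : Fin 3) {r : ℕ}
    (h1 : ∀ e, F.poly.coeff e ≠ 0 → e i + r ≤ F.degree)
    (h2 : ∃ e, F.poly.coeff e ≠ 0 ∧ e i + r = F.degree) :
    F.multiplicity (coordPoint K i) = r := by
  classical
  obtain ⟨hi, hj⟩ := coordPoint_rep (K := K) i
  have hdeg : ∀ e, F.poly.coeff e ≠ 0 → (e.erase i).degree + e i = F.degree := fun e he => by
    rw [← sum_exp he, ← Fin.sum_univ_three, Finsupp.degree_eq_sum,
      ← Finset.add_sum_erase _ _ (Finset.mem_univ i), add_comm,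
      ← Finset.add_sum_erase Finset.univ (⇑e) (Finset.mem_univ i), Finsupp.erase_same, zero_add]
    congr 1
    exact Finset.sum_congr rfl fun j hj => Finsupp.erase_ne (Finset.ne_of_mem_erase hj)
  -- A coordinate point lies in a single affine chart.
  have hset : {n | ∃ l, (coordPoint K i).rep l ≠ 0 ∧ MvPolynomial.homogeneousComponent n
      (F.localEquation (coordPoint K i).rep l) ≠ 0} = {n | MvPolynomial.homogeneousComponent n
      (F.localEquation (coordPoint K i).rep i) ≠ 0} := by
    ext n
    refine ⟨?_, fun h => ⟨i, hi, h⟩⟩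
    rintro ⟨l, hl, h⟩
    obtain rfl : l = i := by_contra fun hne => hl (hj l hne)
    exact h
  rw [multiplicity, hset, coeff_localEquation_of_apply_eq_zero F hj]
  refine le_antisymm (Nat.sInf_le ?hmem) (le_csInf ⟨r, ?hmem⟩ fun n hn => ?_)
  case hmem =>
    obtain ⟨a, ha, har⟩ := h2
    intro h0
    have h3 := congrArg (MvPolynomial.coeff (a.erase i)) h0
    have := hdeg a ha
    rw [MvPolynomial.coeff_homogeneousComponent, if_pos (by omega), MvPolynomial.coeff_sum,
      MvPolynomial.coeff_zero, Finset.sum_eq_single a] at h3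
    · rw [MvPolynomial.coeff_monomial, if_pos rfl] at h3
      exact ha h3
    -- Homogeneity recovers the erased exponent, so no two terms of `F` merge or cancel.
    · intro b hb hba
      rw [MvPolynomial.coeff_monomial, if_neg]
      intro hab
      have hb' := hdeg b (MvPolynomial.mem_support_iff.1 hb)
      refine hba (Finsupp.ext fun j => ?_)
      by_cases hji : j = i
      · rw [hab] at hb'
        rw [hji]
        omega
      · rw [← Finsupp.erase_ne hji, hab, Finsupp.erase_ne hji]
    · intro h
      exact absurd (MvPolynomial.mem_support_iff.2 ha) h
  · rw [Set.mem_ofPred_eq, map_sum] at hn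
    obtain ⟨e, he, hen⟩ := Finset.exists_ne_zero_of_sum_ne_zero hn
    have hc := MvPolynomial.mem_support_iff.1 he
    have h4 := h1 e hc
    have h5 := hdeg e hc
    have h6 : (e.erase i).degree = n := by
      by_contra hne
      refine hen (MvPolynomial.ext _ _ fun b => ?_)
      rw [MvPolynomial.coeff_homogeneousComponent, MvPolynomial.coeff_monomial,
        MvPolynomial.coeff_zero]
      split_ifs with hb hb'
      · exact absurd (hb' ▸ hb) hne
      · rfl
      · rfl
    omega

/-! ### Replacing a coordinate line -/

theorem IsPlaneModelOf.trans {F G H : PlaneCurve K} (h : H.IsPlaneModelOf G)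
    (h' : G.IsPlaneModelOf F) : H.IsPlaneModelOf F :=
  ⟨h'.some.trans h.some⟩

/-- The line `Xᵢ + Xⱼ = 0`. -/
noncomputable def sumLine (K : Type*) [Field K] {i j : Fin 3} (hij : i ≠ j) : PlaneCurve K where
  degree := 1
  poly := MvPolynomial.X i + MvPolynomial.X j
  isHomogeneous := (MvPolynomial.isHomogeneous_X K i).add (MvPolynomial.isHomogeneous_X K j)
  geomIrreducible := by
    classical
    have hc : (MvPolynomial.X i + MvPolynomial.X j :
        MvPolynomial (Fin 3) (AlgebraicClosure K)).coeff (Finsupp.single i 1) = 1 := by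
      rw [MvPolynomial.coeff_add, MvPolynomial.coeff_X, MvPolynomial.coeff_X, if_pos rfl,
        if_neg (by rw [Finsupp.single_left_inj one_ne_zero]; exact hij.symm), add_zero]
    rw [map_add, MvPolynomial.map_X, MvPolynomial.map_X]
    refine MvPolynomial.irreducible_of_totalDegree_eq_one ?_ fun x hx =>
      isUnit_of_dvd_one (hc ▸ hx (Finsupp.single i 1))
    refine ((MvPolynomial.isHomogeneous_X _ i).add
      (MvPolynomial.isHomogeneous_X _ j)).totalDegree ?_
    intro h
    rw [h, MvPolynomial.coeff_zero] at hc
    exact zero_ne_one hc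

theorem not_X_dvd_sumLine {i j : Fin 3} (hij : i ≠ j) (l : Fin 3) :
    ¬ MvPolynomial.X l ∣ (sumLine K hij).poly := by
  have key : ∀ {i j : Fin 3}, i ≠ j → i ≠ l →
      ¬ MvPolynomial.X l ∣ (MvPolynomial.X i + MvPolynomial.X j : MvPolynomial (Fin 3) K) := by
    classical
    intro i j hij hil
    refine MvPolynomial.not_X_dvd_iff.2 ⟨Finsupp.single i 1, ?_, by simp [hil.symm]⟩
    rw [MvPolynomial.coeff_add, MvPolynomial.coeff_X, MvPolynomial.coeff_X, if_pos rfl,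
      if_neg (by rw [Finsupp.single_left_inj one_ne_zero]; exact hij.symm), add_zero]
    exact one_ne_zero
  by_cases hil : i = l
  · have := key hij.symm (by rw [← hil]; exact hij.symm)
    rwa [add_comm] at this
  · exact key hij hil

/-- Over a coordinate line, the line `Xᵢ + Xⱼ = 0` is a plane model. -/
theorem sumLine_isPlaneModelOf {F : PlaneCurve K} {i j : Fin 3} (hij : i ≠ j)
    (hF : MvPolynomial.X i ∣ F.poly) : (sumLine K hij).IsPlaneModelOf F := by
  have hass : Associated (MvPolynomial.X i) F.poly :=
    (MvPolynomial.X_prime (i := i)).irreducible.associated_of_dvd F.irreducible_poly hF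
  have hi : F.coord i = 0 := by
    rw [← MvPolynomial.aeval_X (R := K) F.coord i, aeval_coord_eq_zero_iff]
    exact hass.symm.dvd
  -- `τ` carries `Xᵢ + Xⱼ` to `Xᵢ`, and `σ` undoes it.
  let τ : MvPolynomial (Fin 3) K →ₐ[K] MvPolynomial (Fin 3) K := MvPolynomial.aeval
    fun l => if l = i then MvPolynomial.X i - MvPolynomial.X j else MvPolynomial.X l
  let σ : MvPolynomial (Fin 3) K →ₐ[K] MvPolynomial (Fin 3) K := MvPolynomial.aeval
    fun l => if l = i then MvPolynomial.X i + MvPolynomial.X j else MvPolynomial.X l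
  have hστ : σ.comp τ = AlgHom.id K _ := by
    refine MvPolynomial.algHom_ext fun l => ?_
    by_cases hl : l = i
    · simp [σ, τ, hl, hij.symm]
    · simp [σ, τ, hl]
  let z : Fin 3 → FractionRing F.coordRing := fun l => if l = i then -F.coord j else F.coord l
  have hz : ∀ p, MvPolynomial.aeval z p = MvPolynomial.aeval F.coord (τ p) := by
    have : MvPolynomial.aeval z = (MvPolynomial.aeval F.coord).comp τ := by
      refine MvPolynomial.algHom_ext fun l => ?_
      by_cases hl : l = i
      · simp [z, τ, hl, hi]
      · simp [z, τ, hl]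
    exact fun p => DFunLike.congr_fun this p
  refine isPlaneModelOf_of_generic z ?_ (fun p hp => ?_) (le_antisymm ?_ ?_)
  · simp [sumLine, z, hij.symm]
  · rw [hz, aeval_coord_eq_zero_iff] at hp
    have h1 := map_dvd σ (hass.dvd.trans hp)
    rw [← AlgHom.comp_apply, hστ] at h1
    simpa [σ, sumLine] using h1
  · refine IntermediateField.adjoin_le_iff.2 ?_
    rintro _ ⟨⟨a, b⟩, rfl⟩
    have hmem : ∀ a b, F.coord a / F.coord b ∈ F.functionField := fun a b =>
      IntermediateField.subset_adjoin _ _ ⟨(a, b), rfl⟩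
    simp only [z, SetLike.mem_coe]
    split_ifs
    · rw [neg_div_neg_eq]
      exact hmem _ _
    · rw [neg_div]
      exact neg_mem (hmem _ _)
    · rw [div_neg]
      exact neg_mem (hmem _ _)
    · exact hmem _ _
  · refine IntermediateField.adjoin_le_iff.2 ?_
    rintro _ ⟨⟨a, b⟩, rfl⟩
    by_cases ha : a = i
    · simp [ha, hi]
    by_cases hb : b = i
    · simp [hb, hi]
    refine IntermediateField.subset_adjoin _ _ ⟨(a, b), ?_⟩
    simp [z, ha, hb]

end PlaneCurve

/-! ### The transformation that yields (H) -/

namespace LaurentThree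

/-- A unimodular, degree preserving transformation of exponents. -/
def expEquiv (n : ℤ) : (Fin 3 → ℤ) ≃+ (Fin 3 → ℤ) where
  -- With `u = e 0 + n * e 1`, the first two entries are `-(3u + e 1)` and `-(2u + e 1)`; the matrix
  -- with rows `(3, 1)` and `(2, 1)` has determinant 1. The last entry is forced by preservation of
  -- the sum.
  toFun e := ![-(3 * e 0 + (3 * n + 1) * e 1), -(2 * e 0 + (2 * n + 1) * e 1),
    6 * e 0 + (5 * n + 3) * e 1 + e 2]
  invFun f := ![f 1 - f 0 - n * (2 * f 0 - 3 * f 1), 2 * f 0 - 3 * f 1,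
    3 * f 1 + f 2 + n * (2 * f 0 - 3 * f 1)]
  left_inv e := by
    ext i
    fin_cases i <;> simp <;> ring
  right_inv f := by
    ext i
    fin_cases i <;> simp <;> ring
  map_add' a b := by
    ext i
    fin_cases i <;> simp <;> ring

theorem sum_expEquiv (n : ℤ) (e : Fin 3 → ℤ) : ∑ i, expEquiv n e i = ∑ i, e i := by
  simp only [expEquiv, Fin.sum_univ_three, AddEquiv.coe_mk, Equiv.coe_fn_mk, Matrix.cons_val]
  ring

end LaurentThree

namespace PlaneCurve

variable {K : Type*} [Field K]

open LaurentThree in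
/-- A curve not containing a coordinate line has a plane model with property (H). -/
theorem exists_model_of_not_X_dvd (F : PlaneCurve K)
    (hFX : ∀ i, ¬ MvPolynomial.X i ∣ F.poly) :
    ∃ G : PlaneCurve K, G.IsPlaneModelOf F ∧ G.SatisfiesH := by
  classical
  have hne : ∃ e, F.poly.coeff e ≠ 0 ∧ e 1 = 0 := MvPolynomial.not_X_dvd_iff.1 (hFX 1)
  -- the vertex of the Newton polygon with `e 1 = 0` and `e 0` minimal
  obtain ⟨v, hv, hv1, hvmin⟩ : ∃ v, F.poly.coeff v ≠ 0 ∧ v 1 = 0 ∧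
      ∀ e, F.poly.coeff e ≠ 0 → e 1 = 0 → v 0 ≤ e 0 := by
    obtain ⟨v, hv, hmin⟩ := Finset.exists_min_image (F.poly.support.filter fun e => e 1 = 0)
      (fun e => e 0) (by
        obtain ⟨e, he, he1⟩ := hne
        exact ⟨e, Finset.mem_filter.2 ⟨MvPolynomial.mem_support_iff.2 he, he1⟩⟩)
    rw [Finset.mem_filter, MvPolynomial.mem_support_iff] at hv
    exact ⟨v, hv.1, hv.2, fun e he he1 => hmin e
      (Finset.mem_filter.2 ⟨MvPolynomial.mem_support_iff.2 he, he1⟩)⟩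
  set d := F.degree with hd
  -- This `n` is large enough that every exponent with `e 1 ≥ 1` lies strictly above the vertex.
  obtain ⟨n, hn⟩ : ∃ n : ℕ, n = v 0 + 1 := ⟨_, rfl⟩
  -- the linear form cutting out the vertex
  have hu : ∀ e, F.poly.coeff e ≠ 0 → v 0 ≤ e 0 + n * e 1 := by
    intro e he
    by_cases h : e 1 = 0
    · have := hvmin e he h
      omega
    · have : n * 1 ≤ n * e 1 := Nat.mul_le_mul_left n (Nat.one_le_iff_ne_zero.2 h)
      omega
  -- Otherwise `v` is the only exponent; since no variable divides `F`, the degree would be 0 and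
  -- `F` a constant.
  have hother : ∃ e, F.poly.coeff e ≠ 0 ∧ v 0 + 1 ≤ e 0 + n * e 1 := by
    by_contra hcon
    push Not at hcon
    have heq : ∀ e, F.poly.coeff e ≠ 0 → e 0 = v 0 ∧ e 1 = 0 := by
      intro e he
      have h1 := hcon e he
      by_cases h : e 1 = 0
      · have := hu e he
        rw [h] at h1 this
        omega
      · have : n * 1 ≤ n * e 1 := Nat.mul_le_mul_left n (Nat.one_le_iff_ne_zero.2 h)
        omega
    obtain ⟨e, he, he0⟩ := MvPolynomial.not_X_dvd_iff.1 (hFX 0)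
    obtain ⟨f, hf, hf2⟩ := MvPolynomial.not_X_dvd_iff.1 (hFX 2)
    have h1 := heq e he
    have h2 := heq f hf
    have h3 := sum_exp hf
    have h4 : F.poly.IsHomogeneous 0 := by
      have : F.degree = 0 := by omega
      exact this ▸ F.isHomogeneous
    have h5 := MvPolynomial.totalDegree_eq_zero_iff_eq_C.1
      (Nat.le_zero.1 h4.totalDegree_le)
    refine F.irreducible_poly.not_isUnit (h5 ▸ (isUnit_iff_ne_zero.2 fun h0 => ?_).map MvPolynomial.C)
    rw [h0, map_zero] at h5
    exact F.irreducible_poly.ne_zero h5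
  -- the extents of the transformed Newton polygon
  obtain ⟨A, hA, a, ha, haA⟩ : ∃ A, (∀ e, F.poly.coeff e ≠ 0 → 3 * e 0 + (3 * n + 1) * e 1 ≤ A) ∧
      ∃ e, F.poly.coeff e ≠ 0 ∧ 3 * e 0 + (3 * n + 1) * e 1 = A := by
    obtain ⟨a, ha, hmax⟩ := Finset.exists_max_image F.poly.support
      (fun e => 3 * e 0 + (3 * n + 1) * e 1) ⟨v, MvPolynomial.mem_support_iff.2 hv⟩
    exact ⟨_, fun e he => hmax e (MvPolynomial.mem_support_iff.2 he), a,
      MvPolynomial.mem_support_iff.1 ha, rfl⟩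
  obtain ⟨B, hB, b, hb, hbB⟩ : ∃ B, (∀ e, F.poly.coeff e ≠ 0 → 2 * e 0 + (2 * n + 1) * e 1 ≤ B) ∧
      ∃ e, F.poly.coeff e ≠ 0 ∧ 2 * e 0 + (2 * n + 1) * e 1 = B := by
    obtain ⟨a, ha, hmax⟩ := Finset.exists_max_image F.poly.support
      (fun e => 2 * e 0 + (2 * n + 1) * e 1) ⟨v, MvPolynomial.mem_support_iff.2 hv⟩
    exact ⟨_, fun e he => hmax e (MvPolynomial.mem_support_iff.2 he), a,
      MvPolynomial.mem_support_iff.1 ha, rfl⟩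
  let M := expEquiv n
  -- The shift that makes each coordinate nonnegative with minimum 0. On exponents of degree `d` the
  -- last coordinate becomes `5 * (u - v 0) + 2 * e 1`, which is 0 at `v`.
  let s : Fin 3 → ℤ := ![A, B, -(5 * v 0 + d)]
  have hval : ∀ e : Fin 3 →₀ ℕ,
      (s + M (castExp e)) 0 = A - (3 * e 0 + (3 * n + 1) * e 1 : ℕ) ∧
      (s + M (castExp e)) 1 = B - (2 * e 0 + (2 * n + 1) * e 1 : ℕ) ∧
      (s + M (castExp e)) 2 = 5 * (e 0 + n * e 1 : ℕ) + 3 * e 1 + e 0 + e 2 - 5 * v 0 - d := by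
    intro e
    refine ⟨?_, ?_, ?_⟩ <;> simp [s, M, expEquiv] <;> ring
  have hnonneg : ∀ e, F.poly.coeff e ≠ 0 → ∀ i, 0 ≤ (s + M (castExp e)) i := by
    intro e he i
    obtain ⟨h0, h1, h2⟩ := hval e
    have h3 := hA e he
    have h4 := hB e he
    have h5 := hu e he
    have h6 := sum_exp he
    fin_cases i
    · change 0 ≤ (s + M (castExp e)) 0
      omega
    · change 0 ≤ (s + M (castExp e)) 1
      omega
    · change 0 ≤ (s + M (castExp e)) 2
      omega
  obtain ⟨G, hG⟩ := exists_isMonomialTransform hnonneg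
  have himage : ∀ e, F.poly.coeff e ≠ 0 → ∃ f, G.coeff f ≠ 0 ∧ castExp f = s + M (castExp e) := by
    intro e he
    obtain ⟨f, hf⟩ := exists_castExp (hnonneg e he)
    exact ⟨f, by rwa [hG.coeff_eq hf], hf⟩
  have hcast : ∀ {f e : Fin 3 →₀ ℕ}, castExp f = s + M (castExp e) →
      (f 0 : ℤ) = A - (3 * e 0 + (3 * n + 1) * e 1 : ℕ) ∧
      (f 1 : ℤ) = B - (2 * e 0 + (2 * n + 1) * e 1 : ℕ) ∧
      (f 2 : ℤ) = 5 * (e 0 + n * e 1 : ℕ) + 3 * e 1 + e 0 + e 2 - 5 * v 0 - d := by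
    intro f e hfe
    rw [← castExp_apply, ← castExp_apply, ← castExp_apply, hfe]
    exact hval e
  have hlin : ∀ e : Fin 3 →₀ ℕ,
      3 * e 0 + (3 * n + 1) * e 1 = 3 * (e 0 + n * e 1) + e 1 ∧
      2 * e 0 + (2 * n + 1) * e 1 = 2 * (e 0 + n * e 1) + e 1 := fun e => by
    constructor <;> ring
  have hvlin : v 0 + n * v 1 = v 0 := by rw [hv1, mul_zero, add_zero]
  obtain ⟨o, ho, hou⟩ := hother
  have hAo := hA o ho
  have hBo := hB o ho
  have ho1 := (hlin o).1
  have ho2 := (hlin o).2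
  obtain ⟨fv, hfv, hfv'⟩ := himage v hv
  obtain ⟨fa, hfa, hfa'⟩ := himage a ha
  obtain ⟨fb, hfb, hfb'⟩ := himage b hb
  obtain ⟨v0, v1, v2⟩ := hcast hfv'
  obtain ⟨a0, a1, a2⟩ := hcast hfa'
  obtain ⟨b0, b1, b2⟩ := hcast hfb'
  have hvl := hlin v
  have hvs := sum_exp hv
  have hGX : ∀ i, ∃ e, G.coeff e ≠ 0 ∧ e i = 0 := by
    intro i
    fin_cases i
    · exact ⟨fa, hfa, show fa 0 = 0 by omega⟩
    · exact ⟨fb, hfb, show fb 1 = 0 by omega⟩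
    · exact ⟨fv, hfv, show fv 2 = 0 by omega⟩
  have hGdeg : ∀ f, G.coeff f ≠ 0 → f 0 + f 1 + f 2 = A + B - 5 * v 0 := by
    intro f hf
    obtain ⟨e, he, hfe⟩ := hG.coeff_ne_zero hf
    obtain ⟨h0, h1, h2⟩ := hcast hfe
    have h3 := hlin e
    have h4 := sum_exp he
    omega
  have hmapX : ∀ {p : MvPolynomial (Fin 3) K} (i : Fin 3),
      (∃ e, p.coeff e ≠ 0 ∧ e i = 0) →
      ¬ MvPolynomial.X i ∣ MvPolynomial.map (algebraMap K (AlgebraicClosure K)) p := by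
    rintro p i ⟨e, he, hei⟩
    refine MvPolynomial.not_X_dvd_iff.2 ⟨e, ?_, hei⟩
    rwa [MvPolynomial.coeff_map, map_ne_zero]
  -- The exponent `o` gives `A ≥ 3 * (v 0 + 1)` and `B ≥ 2 * (v 0 + 1)`, so none of the natural
  -- subtractions below truncates, and both multiplicities are at least 2.
  let C : PlaneCurve K :=
    { degree := A + B - 5 * v 0
      poly := G
      isHomogeneous := by
        intro f hf
        rw [← hGdeg f hf, ← Fin.sum_univ_three]
        simp [Finsupp.weight_apply, Finsupp.sum_fintype]
      geomIrreducible := (hG.map _).irreducible F.geomIrreducible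
        (fun i => hmapX i (MvPolynomial.not_X_dvd_iff.1 (hFX i))) (fun i => hmapX i (hGX i)) }
  have hC0 : C.multiplicity (coordPoint K 0) = B - 2 * v 0 := by
    refine multiplicity_coordPoint C 0 (fun f hf => ?_) ⟨fv, hfv, ?_⟩
    · change f 0 + (B - 2 * v 0) ≤ A + B - 5 * v 0
      obtain ⟨e, he, hfe⟩ := hG.coeff_ne_zero hf
      have h0 := (hcast hfe).1
      have h1 := hu e he
      have h2 := hlin e
      omega
    · change fv 0 + (B - 2 * v 0) = A + B - 5 * v 0
      omega
  have hC1 : C.multiplicity (coordPoint K 1) = A - 3 * v 0 := by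
    refine multiplicity_coordPoint C 1 (fun f hf => ?_) ⟨fv, hfv, ?_⟩
    · change f 1 + (A - 3 * v 0) ≤ A + B - 5 * v 0
      obtain ⟨e, he, hfe⟩ := hG.coeff_ne_zero hf
      have h0 := (hcast hfe).2.1
      have h1 := hu e he
      have h2 := hlin e
      omega
    · change fv 1 + (A - 3 * v 0) = A + B - 5 * v 0
      omega
  refine ⟨C, isPlaneModelOf_of_isMonomialTransform (sum_expEquiv n) hFX
    (fun i => MvPolynomial.not_X_dvd_iff.2 (hGX i)) hG,
    coordPoint K 0, coordPoint K 1, coordPoint_injective.ne (by decide), ?_, ?_, ?_⟩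
  · rw [hC0]
    omega
  · rw [hC1]
    omega
  · rw [hC0, hC1]
    change B - 2 * v 0 + (A - 3 * v 0) = A + B - 5 * v 0
    omega

/-- Every plane curve has a plane model with property (H). -/
theorem exists_model (F : PlaneCurve K) :
    ∃ G : PlaneCurve K, G.IsPlaneModelOf F ∧ G.SatisfiesH := by
  by_cases hF : ∀ i, ¬ MvPolynomial.X i ∣ F.poly
  · exact exists_model_of_not_X_dvd F hF
  · push Not at hF
    obtain ⟨i, hi⟩ := hF
    obtain ⟨j, hij⟩ := exists_ne i
    obtain ⟨G, hG, hH⟩ := exists_model_of_not_X_dvd _ (not_X_dvd_sumLine (K := K) hij.symm)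
    exact ⟨G, hG.trans (sumLine_isPlaneModelOf hij.symm hi), hH⟩

end PlaneCurve

theorem proposition5p3 {K : Type*} [Field K] (F : PlaneCurve K)
    (γ₁ γ₂ : F.RationalBranch) (hγ : γ₁ ≠ γ₂) :
    ∃ G : PlaneCurve K, G.IsPlaneModelOf F ∧ G.SatisfiesH := by
  exact F.exists_model
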